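/- Let $M$ be a smooth ($C^\infty$) Hausdorff manifold of finite dimension $d\ge 0$, without boundary. For $n\ge 0$ let $\mathrm{Der}^n(TM)$ be the space of multiderivations of degree $n$ of $TM$, i.e. of alternating $\mathbb R$-multilinear maps $D:\Gamma^\infty(TM)^{n+1}\to\Gamma^\infty(TM)$ for which there is a map $\sigma_D:\Gamma^\infty(TM)^{n}\to\Gamma^\infty(TM)$ (the symbol) such that $$D(X_1,\dots,X_n,fY)=f\,D(X_1,\dots,X_n,Y)+\sigma_D(X_1,\dots,X_n)(f)\,Y$$ for all vector fields $X_1,\dots,X_n,Y$ and all $f\in C^\infty(M)$. For $D_1\in\mathrm{Der}^p(TM)$, $D_2\in\mathrm{Der}^q(TM)$ put $$[D_1,D_2]=(-1)^{pq}D_1\circ D_2-D_2\circ D_1,$$ $$(D_1\circ D_2)(X_0,\dots,X_{p+q})=\sum_{\pi}(-1)^\pi D_1\bigl(D_2(X_{\pi(0)},\dots,X_{\pi(q)}),X_{\pi(q+1)},\dots,X_{\pi(p+q)}\bigr),$$ the sum running over all $(q+1,p)$-shuffles $\pi$, and extend the bracket to formal power series in $t$ coefficientwise. Let $m_0\in\mathrm{Der}^1(TM)$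 be the Lie bracket of vector fields, i.e. the bracket of the tangent Lie algebroid $TM$ (with the identity as anchor). Then the Lie algebroid $TM$ is rigid, i.e. each of its formal deformations is trivial: for every formal power series $m_t=m_0+t\,m_1+t^2m_2+\cdots$ with all $m_k\in\mathrm{Der}^1(TM)$ and $[m_t,m_t]=0$ there is a formal power series $D_t=t\,D_1+t^2D_2+\cdots$ with all $D_k\in\mathrm{Der}^0(TM)$ such that $$m_0=\exp(\mathrm{ad}_{D_t})\,m_t=\sum_{k=0}^\infty\frac1{k!}(\mathrm{ad}_{D_t})^k m_t,\qquad \mathrm{ad}_{D_t}=[D_t,\,\cdot\,].$$ -/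

import Mathlib

open Bundle Manifold
open scoped ContDiff Manifold

noncomputable section

namespace LieAlgebroidDef

/-! ### Gerstenhaber product and Crainic-Moerdijk bracket -/

section Bracket

variable {Γ : Type*} [AddCommGroup Γ]

/-- `τ` is a shuffle of the first `a` and the remaining `N - a` indices:
it is increasing on `{0, …, a - 1}` and on `{a, …, N - 1}`. -/
def IsShuffle (a : ℕ) {N : ℕ} (τ : Equiv.Perm (Fin N)) : Prop :=
  (∀ i j : Fin N, i < j → (j : ℕ) < a → τ i < τ j) ∧
    (∀ i j : Fin N, a ≤ (i : ℕ) → i < j → τ i < τ j)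

instance (a N : ℕ) : DecidablePred (IsShuffle a (N := N)) := fun τ => by
  unfold IsShuffle; infer_instance

/-- The Gerstenhaber product of maps of degree `p` (with `p + 1` arguments) and of degree `q`,
`(D₁ ∘ D₂)(s₀, …, s_{p+q}) = ∑_τ (-1)^τ D₁ (D₂ (s_{τ 0}, …, s_{τ q}), s_{τ (q+1)}, …, s_{τ (p+q)})`,
summed over the `(q + 1, p)`-shuffles `τ`. Here `n = p + q` is the degree of the product. -/
def gerstenhaber {p q n : ℕ} (h : n = p + q)
    (D₁ : (Fin (p + 1) → Γ) → Γ) (D₂ : (Fin (q + 1) → Γ) → Γ) : (Fin (n + 1) → Γ) → Γ :=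
  fun s => ∑ τ : Equiv.Perm (Fin (n + 1)) with IsShuffle (q + 1) τ,
    ((Equiv.Perm.sign τ : ℤˣ) : ℤ) •
      D₁ (Fin.cons (D₂ fun i : Fin (q + 1) => s (τ ⟨i, by omega⟩))
        (fun j : Fin p => s (τ ⟨q + 1 + j, by omega⟩)))

/-- The bracket `[D₁, D₂] = (-1)^{pq} D₁ ∘ D₂ - D₂ ∘ D₁` for `D₁` of degree `p` and `D₂` of
degree `q`; it has degree `n = p + q`. -/
def cmBracket {p q n : ℕ} (h : n = p + q)
    (D₁ : (Fin (p + 1) → Γ) → Γ) (D₂ : (Fin (q + 1) → Γ) → Γ) : (Fin (n + 1) → Γ) → Γ :=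
  fun s => (-1 : ℤ) ^ (p * q) • gerstenhaber h D₁ D₂ s -
    gerstenhaber (h.trans (Nat.add_comm p q)) D₂ D₁ s

end Bracket

/-! ### Formal series

A formal power series `v₀ + t v₁ + t² v₂ + ⋯` with coefficients in a module `V` is the sequence
`ℕ → V` of its coefficients. -/

section FormalSeries

variable {Γ : Type*} [AddCommGroup Γ]

/-- The bracket of formal series, `[D_t, E_t] = ∑ₙ tⁿ ∑_{i + j = n} [Dᵢ, Eⱼ]`. -/
def cmBracketSeries {p q n : ℕ} (h : n = p + q)
    (D : ℕ → (Fin (p + 1) → Γ) → Γ) (E : ℕ → (Fin (q + 1) → Γ) → Γ) :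
    ℕ → (Fin (n + 1) → Γ) → Γ :=
  fun k => ∑ ij ∈ Finset.HasAntidiagonal.antidiagonal k, cmBracket h (D ij.1) (E ij.2)

/-- `ad_{D_t} m_t = [D_t, m_t]` for a series `D_t` of degree `0`, and `m_t` of degree `q`. -/
def adSeries {q : ℕ} (D : ℕ → (Fin (0 + 1) → Γ) → Γ) (m : ℕ → (Fin (q + 1) → Γ) → Γ) :
    ℕ → (Fin (q + 1) → Γ) → Γ :=
  cmBracketSeries (Nat.zero_add q).symm D m

/-- `exp (ad_{D_t}) m_t = ∑ₖ (1 / k!) (ad_{D_t})^k m_t` for a series `D_t = t D₁ + t² D₂ + ⋯`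
without constant term. Since `ad_{D_t}` then raises the order in `t` by at least one, the
coefficient of `tⁿ` only receives contributions from `k ≤ n`. -/
def expAd [Module ℝ Γ] {q : ℕ} (D : ℕ → (Fin (0 + 1) → Γ) → Γ)
    (m : ℕ → (Fin (q + 1) → Γ) → Γ) : ℕ → (Fin (q + 1) → Γ) → Γ :=
  fun n => ∑ k ∈ Finset.range (n + 1),
    ((k.factorial : ℝ)⁻¹) • ((adSeries D)^[k] m) n

end FormalSeries

/-! ### Sections of vector bundles, multiderivations, Lie algebroids -/

section Algebroid

variable {d : ℕ} {M : Type*} [TopologicalSpace M] [ChartedSpace (EuclideanSpace ℝ (Fin d)) M]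

/-- Smooth vector fields on `M`. -/
abbrev VectorFields (d : ℕ) (M : Type*) [TopologicalSpace M]
    [ChartedSpace (EuclideanSpace ℝ (Fin d)) M] [IsManifold (𝓡 d) ∞ M] : Type _ :=
  ContMDiffSection (𝓡 d) (EuclideanSpace ℝ (Fin d)) ∞ (fun x : M => TangentSpace (𝓡 d) x)

/-- The derivative `X(f)` of a smooth function `f` along a vector field `X`. -/
def VectorFields.applyFun [IsManifold (𝓡 d) ∞ M] (X : VectorFields d M)
    (f : C^∞⟮𝓡 d, M; ℝ⟯) (x : M) : ℝ :=
  mvfderiv (𝓡 d) f x (X x)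

variable (F : Type*) [NormedAddCommGroup F] [NormedSpace ℝ F]
  (V : M → Type*) [TopologicalSpace (TotalSpace F V)]
  [∀ x, TopologicalSpace (V x)] [∀ x, AddCommGroup (V x)] [∀ x, Module ℝ (V x)]
  [FiberBundle F V] [VectorBundle ℝ F V]

/-- Smooth sections of the vector bundle `V` over the `d`-dimensional manifold `M`. -/
abbrev Sections (d : ℕ) {M : Type*} [TopologicalSpace M]
    [ChartedSpace (EuclideanSpace ℝ (Fin d)) M]
    (F : Type*) [NormedAddCommGroup F] [NormedSpace ℝ F]
    (V : M → Type*) [TopologicalSpace (TotalSpace F V)]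
    [∀ x, TopologicalSpace (V x)] [∀ x, AddCommGroup (V x)] [∀ x, Module ℝ (V x)]
    [FiberBundle F V] [VectorBundle ℝ F V] : Type _ := ContMDiffSection (𝓡 d) F ∞ V

variable {F V}

/-- The product `f s` of a smooth function and a smooth section. -/
def funSMul (f : C^∞⟮𝓡 d, M; ℝ⟯) (s : Sections d F V) : Sections d F V :=
  ⟨fun x => f x • s x, f.contMDiff.smul_section s.contMDiff⟩

/-- `D` is a multiderivation of degree `n`: an alternating `ℝ`-multilinear map of `n + 1` sections
with a symbol `σ` such that
`D (s₁, …, sₙ, f e) = f D (s₁, …, sₙ, e) + σ (s₁, …, sₙ)(f) e`. -/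
def IsMultiderivation [IsManifold (𝓡 d) ∞ M] {n : ℕ}
    (D : (Sections d F V) [⋀^Fin (n + 1)]→ₗ[ℝ] (Sections d F V)) : Prop :=
  ∃ σ : (Fin n → Sections d F V) → VectorFields d M,
    ∀ (s : Fin n → Sections d F V) (f : C^∞⟮𝓡 d, M; ℝ⟯) (e : Sections d F V) (x : M),
      D (Fin.snoc (α := fun _ => Sections d F V) s (funSMul f e)) x =
        f x • D (Fin.snoc (α := fun _ => Sections d F V) s e) x + (σ s).applyFun f x • e x

variable (d F V)

/-- A Lie algebroid structure on the vector bundle `V → M`: a Lie bracket on the smooth sections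
and a smooth vector bundle morphism `V → TM`, the anchor, satisfying the Leibniz rule. -/
structure LieAlgebroid [IsManifold (𝓡 d) ∞ M] [FiniteDimensional ℝ F]
    [ContMDiffVectorBundle ∞ F V (𝓡 d)] where
  /-- the Lie bracket on sections -/
  bracket : (Sections d F V) [⋀^Fin 2]→ₗ[ℝ] (Sections d F V)
  jacobi : ∀ a b c : Sections d F V,
    bracket ![a, bracket ![b, c]] + bracket ![b, bracket ![c, a]] +
      bracket ![c, bracket ![a, b]] = 0
  /-- the anchor, fibrewise -/
  anchor : ∀ x : M, V x →ₗ[ℝ] TangentSpace (𝓡 d) x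
  /-- the anchor maps smooth sections to smooth vector fields -/
  anchor_smooth : ∀ s : Sections d F V,
    ContMDiff (𝓡 d) ((𝓡 d).prod 𝓘(ℝ, EuclideanSpace ℝ (Fin d))) ∞
      (fun x => (⟨x, anchor x (s x)⟩ : TangentBundle (𝓡 d) M))
  leibniz : ∀ (a : Sections d F V) (f : C^∞⟮𝓡 d, M; ℝ⟯) (b : Sections d F V) (x : M),
    bracket ![a, funSMul f b] x =
      f x • bracket ![a, b] x + mvfderiv (𝓡 d) f x (anchor x (a x)) • b x

variable {d F V}

/-- A formal deformation of the bracket `m₀`: a series `m_t = m₀ + t m₁ + t² m₂ + ⋯` of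
multiderivations of degree `1` with `[m_t, m_t] = 0`. -/
structure IsFormalDeformation [IsManifold (𝓡 d) ∞ M]
    (m₀ : (Sections d F V) [⋀^Fin (1 + 1)]→ₗ[ℝ] (Sections d F V))
    (m : ℕ → (Sections d F V) [⋀^Fin (1 + 1)]→ₗ[ℝ] (Sections d F V)) : Prop where
  zero : m 0 = m₀
  isMultiderivation : ∀ k, IsMultiderivation (m k)
  bracket_self : ∀ k, cmBracketSeries (n := 2) rfl (fun i => ⇑(m i)) (fun i => ⇑(m i)) k = 0

/-- Two formal series `m_t` and `m'_t` of brackets are equivalent: `m'_t = exp (ad_{D_t}) m_t` for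
a series `D_t = t D₁ + t² D₂ + ⋯` of multiderivations of degree `0`. -/
def FormallyEquivalent [IsManifold (𝓡 d) ∞ M]
    (m m' : ℕ → (Sections d F V) [⋀^Fin (1 + 1)]→ₗ[ℝ] (Sections d F V)) : Prop :=
  ∃ D : ℕ → (Sections d F V) [⋀^Fin (0 + 1)]→ₗ[ℝ] (Sections d F V),
    D 0 = 0 ∧ (∀ k, IsMultiderivation (D k)) ∧
      ∀ k, ⇑(m' k) = expAd (fun i => ⇑(D i)) (fun i => ⇑(m i)) k

/-- A formal deformation of `m₀` is trivial if it is equivalent to the constant series `m₀`. -/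
def IsTrivialDeformation [IsManifold (𝓡 d) ∞ M]
    (m₀ : (Sections d F V) [⋀^Fin (1 + 1)]→ₗ[ℝ] (Sections d F V))
    (m : ℕ → (Sections d F V) [⋀^Fin (1 + 1)]→ₗ[ℝ] (Sections d F V)) : Prop :=
  FormallyEquivalent m (fun k => if k = 0 then m₀ else 0)

/-- A Lie algebroid is rigid if all its formal deformations are trivial. -/
def LieAlgebroid.IsRigid [IsManifold (𝓡 d) ∞ M] [FiniteDimensional ℝ F]
    [ContMDiffVectorBundle ∞ F V (𝓡 d)] (A : LieAlgebroid d F V) : Prop :=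
  ∀ m : ℕ → (Sections d F V) [⋀^Fin (1 + 1)]→ₗ[ℝ] (Sections d F V),
    IsFormalDeformation A.bracket m → IsTrivialDeformation A.bracket m

end Algebroid

/-! ### The tangent Lie algebroid -/

section Tangent

variable {d : ℕ} {M : Type*} [TopologicalSpace M] [ChartedSpace (EuclideanSpace ℝ (Fin d)) M]
  [IsManifold (𝓡 d) ∞ M]

theorem VectorFields.mdifferentiableAt (X : VectorFields d M) (x : M) :
    MDifferentiableAt (𝓡 d) ((𝓡 d).prod 𝓘(ℝ, EuclideanSpace ℝ (Fin d)))
      (fun y => (⟨y, X y⟩ : TangentBundle (𝓡 d) M)) x :=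
  (X.contMDiff x).mdifferentiableAt (by simp)

/-- The Lie bracket `[X, Y]` of smooth vector fields. -/
def lieBracketFields (X Y : VectorFields d M) : VectorFields d M :=
  ⟨VectorField.mlieBracket (𝓡 d) X Y, fun x => by
    have : IsManifold (𝓡 d) (((⊤ : ℕ∞) : WithTop ℕ∞) + 1) M := by
      simpa using (inferInstance : IsManifold (𝓡 d) ∞ M)
    have : IsManifold (𝓡 d) (minSmoothness ℝ 2) M := by simpa using (inferInstance : IsManifold (𝓡 d) 2 M)
    exact ContMDiffAt.mlieBracket_vectorField (n := ⊤) (m := ⊤) (X.contMDiff x) (Y.contMDiff x)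
      (by simp)⟩

theorem lieBracketFields_apply (X Y : VectorFields d M) (x : M) :
    lieBracketFields X Y x = VectorField.mlieBracket (𝓡 d) X Y x := rfl

theorem lieBracketFields_self (X : VectorFields d M) : lieBracketFields X X = 0 := by
  ext1 x
  simp [lieBracketFields_apply]

theorem lieBracketFields_swap (X Y : VectorFields d M) :
    lieBracketFields X Y = -lieBracketFields Y X := by
  ext1 x
  exact VectorField.mlieBracket_swap_apply

theorem lieBracketFields_add_left (X X' Y : VectorFields d M) :
    lieBracketFields (X + X') Y = lieBracketFields X Y + lieBracketFields X' Y := by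
  ext1 x
  exact VectorField.mlieBracket_add_left (X.mdifferentiableAt x) (X'.mdifferentiableAt x)

theorem lieBracketFields_smul_left (c : ℝ) (X Y : VectorFields d M) :
    lieBracketFields (c • X) Y = c • lieBracketFields X Y := by
  ext1 x
  exact VectorField.mlieBracket_const_smul_left (X.mdifferentiableAt x)

theorem lieBracketFields_jacobi (X Y Z : VectorFields d M) :
    lieBracketFields X (lieBracketFields Y Z) =
      lieBracketFields (lieBracketFields X Y) Z + lieBracketFields Y (lieBracketFields X Z) := by
  have : IsManifold (𝓡 d) (minSmoothness ℝ 3) M := by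
    simpa using (inferInstance : IsManifold (𝓡 d) 3 M)
  have h (W : VectorFields d M) (x : M) := (W.contMDiff x).of_le
    (show minSmoothness ℝ 2 ≤ ∞ by simp only [minSmoothness_of_isRCLikeNormedField]; exact ENat.LEInfty.out)
  ext1 x
  exact VectorField.leibniz_identity_mlieBracket_apply (h X x) (h Y x) (h Z x)

variable (d M)

/-- The Lie bracket of vector fields as an alternating map. -/
def tangentBracket : (VectorFields d M) [⋀^Fin 2]→ₗ[ℝ] (VectorFields d M) where
  toFun v := lieBracketFields (v 0) (v 1)
  map_update_add' := by
    intro inst m i x y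
    obtain rfl : inst = instDecidableEqFin 2 := Subsingleton.elim _ _
    fin_cases i
    · simpa using lieBracketFields_add_left x y (m 1)
    · simp [lieBracketFields_swap (m 0), lieBracketFields_add_left, add_comm]
  map_update_smul' := by
    intro inst m i c x
    obtain rfl : inst = instDecidableEqFin 2 := Subsingleton.elim _ _
    fin_cases i
    · simpa using lieBracketFields_smul_left c x (m 1)
    · simp [lieBracketFields_swap (m 0), lieBracketFields_smul_left]
  map_eq_zero_of_eq' := by
    intro v i j h hij
    have h01 : v 0 = v 1 := by
      fin_cases i <;> fin_cases j <;> simp_all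
    rw [h01, lieBracketFields_self]

theorem tangentBracket_apply (X Y : VectorFields d M) :
    tangentBracket d M ![X, Y] = lieBracketFields X Y := rfl

/-- The tangent Lie algebroid `TM`: the Lie bracket of vector fields, with the identity as
anchor. -/
def tangentLieAlgebroid :
    LieAlgebroid d (EuclideanSpace ℝ (Fin d)) (fun x : M => TangentSpace (𝓡 d) x) where
  bracket := tangentBracket d M
  jacobi X Y Z := by
    simp only [tangentBracket_apply]
    rw [lieBracketFields_jacobi X Y Z, lieBracketFields_swap Z (lieBracketFields X Y),
      lieBracketFields_swap Z X, ← neg_one_smul ℝ (lieBracketFields X Z),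
      lieBracketFields_swap Y ((-1 : ℝ) • _), lieBracketFields_smul_left,
      lieBracketFields_swap Y (lieBracketFields X Z)]
    simp
  anchor := fun _ => LinearMap.id
  anchor_smooth := fun s => s.contMDiff
  leibniz X f Y x := by
    have h := VectorField.mlieBracket_smul_right (V := X)
      (f.contMDiff.mdifferentiable (by simp) x) (VectorFields.mdifferentiableAt Y x)
    rw [add_comm]
    exact h

end Tangent

end LieAlgebroidDef

end

/-! The symbol of the deformation is itself the trivialisation. Let `σ_t = σ₀ + t σ₁ + ⋯` be the
symbol of `m_t`. For `d > 0` it is unique, so `σ₀ = id`, and it is linear over the smooth functions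
(`HasSymbol.map_funSMul`). The equation `[m_t, m_t] = 0` is the Jacobi identity for `m_t`. Replacing
`Z` by `f Z` in it and comparing the terms proportional to `Z` shows that `σ_t (m_t(X, Y))` and
`[σ_t X, σ_t Y]` act in the same way on every `f`. Hence they are equal (`sum_symbol_eq`), and `σ_t`
carries `m_t` to the Lie bracket.

It remains to write this conjugation as `exp (ad_{D_t})`. A series with constant term `1` is an
exponential, so `σ_t = exp D_t` (`exists_expSeries_eq`). The logarithm is taken inside the algebra
`smoothEnd`, so each `D_k` is linear over functions and is a derivation of degree `0` with symbol
`0`. On bilinear maps, `ad_D` is postcomposition with `D` minus precomposition in each of the two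
arguments. These three operators commute, so `exp (ad_D) m = e^D m(e^{-D} ·, e^{-D} ·)`, which is
the Lie bracket (`conv_expSeries_adOp`). When `d = 0` all vector fields vanish. -/

noncomputable section

namespace TangentRigidity

open PowerSeries Finset LieAlgebroidDef

/-! ### Exponentials of power series over a noncommutative ring -/

section ExpSeries

variable {R : Type*} [Ring R]

theorem coeff_mul_eq_zero_of_lt {a b : R⟦X⟧} {u v n : ℕ} (ha : ∀ i < u, coeff i a = 0)
    (hb : ∀ i < v, coeff i b = 0) (hn : n < u + v) : coeff n (a * b) = 0 := by
  rw [coeff_mul]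
  refine sum_eq_zero fun p hp => ?_
  rw [HasAntidiagonal.mem_antidiagonal] at hp
  by_cases h : p.1 < u
  · rw [ha _ h, zero_mul]
  · rw [hb _ (by omega), mul_zero]

theorem coeff_pow_eq_zero_of_lt {a : R⟦X⟧} (ha : coeff 0 a = 0) (k : ℕ) :
    ∀ n < k, coeff n (a ^ k) = 0 := by
  induction k with
  | zero => intro n hn; omega
  | succ k ih =>
    intro n hn
    rw [pow_succ]
    refine coeff_mul_eq_zero_of_lt ih (v := 1) (fun i hi => ?_) hn
    rwa [Nat.lt_one_iff.1 hi]

/-- Telescoping writes the difference as a sum of products of one factor `a - b`, of order at least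
`n`, and `k` factors of order at least one. Thus powers above the first do not see a change of the
`n`-th coefficient in degree `n`. -/
theorem coeff_pow_sub_pow_eq_zero {a b : R⟦X⟧} (ha : coeff 0 a = 0) (hb : coeff 0 b = 0) {n : ℕ}
    (h : ∀ i < n, coeff i a = coeff i b) (k : ℕ) :
    ∀ i < n + k, coeff i (a ^ (k + 1) - b ^ (k + 1)) = 0 := by
  induction k with
  | zero => intro i hi; simp [h i hi]
  | succ k ih =>
    intro i hi
    have : a ^ (k + 1 + 1) - b ^ (k + 1 + 1) =
        a ^ (k + 1) * (a - b) + (a ^ (k + 1) - b ^ (k + 1)) * b := by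
      rw [pow_succ a (k + 1), pow_succ b (k + 1)]; noncomm_ring
    rw [this, map_add, coeff_mul_eq_zero_of_lt (coeff_pow_eq_zero_of_lt ha (k + 1))
      (v := n) (fun i hi => by simp [h i hi]) (by omega),
      coeff_mul_eq_zero_of_lt ih (v := 1) (fun i hi => ?_) hi, add_zero]
    rwa [Nat.lt_one_iff.1 hi]

variable [Algebra ℝ R]

/-- The exponential `∑ₖ aᵏ / k!` of a power series `a` without constant term. -/
def expSeries (a : R⟦X⟧) : R⟦X⟧ :=
  PowerSeries.mk fun n => ∑ k ∈ range (n + 1), (k.factorial : ℝ)⁻¹ • coeff n (a ^ k)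

theorem coeff_expSeries {a : R⟦X⟧} (ha : coeff 0 a = 0) {n N : ℕ} (h : n ≤ N) :
    coeff n (expSeries a) = ∑ k ∈ range (N + 1), (k.factorial : ℝ)⁻¹ • coeff n (a ^ k) := by
  rw [expSeries, coeff_mk]
  refine sum_subset (range_mono (by omega)) fun k _ hk => ?_
  rw [coeff_pow_eq_zero_of_lt ha k n (by simpa using hk), smul_zero]

theorem expSeries_zero : expSeries (0 : R⟦X⟧) = 1 := by
  ext n
  rw [expSeries, coeff_mk, sum_range_succ']
  simp

/-- Both sides are sums of the same terms `aⁱ bʲ / (i! j!)`: the left over the triangle `i + j ≤ n`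
(binomial theorem), the right over the square `i, j ≤ n`. Outside the triangle the order of `aⁱ bʲ`
exceeds `n`. -/
theorem expSeries_add {a b : R⟦X⟧} (ha : coeff 0 a = 0) (hb : coeff 0 b = 0)
    (hab : Commute a b) : expSeries (a + b) = expSeries a * expSeries b := by
  ext n
  set F : ℕ × ℕ → R := fun p =>
    ((p.1.factorial : ℝ)⁻¹ * (p.2.factorial : ℝ)⁻¹) • coeff n (a ^ p.1 * b ^ p.2) with hF
  have hl : coeff n (expSeries (a + b)) = ∑ k ∈ range (n + 1), ∑ p ∈ antidiagonal k, F p := by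
    rw [expSeries, coeff_mk]
    refine sum_congr rfl fun k _ => ?_
    rw [hab.add_pow', map_sum, smul_sum]
    refine sum_congr rfl fun p hp => ?_
    obtain rfl := HasAntidiagonal.mem_antidiagonal.1 hp
    rw [hF, map_nsmul, ← Nat.cast_smul_eq_nsmul ℝ, smul_smul, Nat.cast_add_choose]
    congr 1
    field_simp
  have hr : coeff n (expSeries a * expSeries b) =
      ∑ p ∈ range (n + 1) ×ˢ range (n + 1), F p := by
    rw [coeff_mul, sum_product]
    have h : ∀ p ∈ antidiagonal n, coeff p.1 (expSeries a) * coeff p.2 (expSeries b) =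
        ∑ i ∈ range (n + 1), ∑ j ∈ range (n + 1), ((i.factorial : ℝ)⁻¹ * (j.factorial : ℝ)⁻¹) •
          (coeff p.1 (a ^ i) * coeff p.2 (b ^ j)) := by
      intro p hp
      have := HasAntidiagonal.mem_antidiagonal.1 hp
      rw [coeff_expSeries ha (show p.1 ≤ n by omega), coeff_expSeries hb (show p.2 ≤ n by omega),
        sum_mul_sum]
      exact sum_congr rfl fun i _ => sum_congr rfl fun j _ => smul_mul_smul_comm _ _ _ _
    rw [sum_congr rfl h, sum_comm]
    refine sum_congr rfl fun i _ => ?_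
    rw [sum_comm]
    refine sum_congr rfl fun j _ => ?_
    rw [hF]
    dsimp only
    rw [coeff_mul, smul_sum]
  rw [hl, hr, ← sum_subset (filter_subset (fun p : ℕ × ℕ => p.1 + p.2 ∈ range (n + 1)) _),
    ← sum_fiberwise_of_maps_to (g := fun p : ℕ × ℕ => p.1 + p.2) (t := range (n + 1))
      (fun p hp => (mem_filter.1 hp).2)]
  · refine sum_congr rfl fun k hk => sum_congr ?_ fun _ _ => rfl
    ext p
    simp only [mem_range] at hk
    simp only [HasAntidiagonal.mem_antidiagonal, mem_filter, mem_product, mem_range]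
    omega
  · intro p hp hp'
    have h : ¬ p.1 + p.2 ∈ range (n + 1) := fun h => hp' (mem_filter.2 ⟨hp, h⟩)
    rw [hF]
    dsimp only
    rw [coeff_mul_eq_zero_of_lt (coeff_pow_eq_zero_of_lt ha p.1) (coeff_pow_eq_zero_of_lt hb p.2)
      (by rw [mem_range] at h; omega), smul_zero]

theorem expSeries_neg_mul {a : R⟦X⟧} (ha : coeff 0 a = 0) :
    expSeries (-a) * expSeries a = 1 := by
  rw [← expSeries_add (by rw [map_neg, ha, neg_zero]) ha (Commute.refl a).neg_left,
    neg_add_cancel, expSeries_zero]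

/-- Only the linear term of the exponential contributes. This makes the equation `exp a = r`
solvable one coefficient at a time. -/
theorem coeff_expSeries_sub {a b : R⟦X⟧} (ha : coeff 0 a = 0) (hb : coeff 0 b = 0) {n : ℕ}
    (h : ∀ i < n, coeff i a = coeff i b) :
    coeff n (expSeries a) - coeff n (expSeries b) = coeff n a - coeff n b := by
  rw [coeff_expSeries ha n.le_succ, coeff_expSeries hb n.le_succ, ← sum_sub_distrib,
    sum_range_succ', sum_range_succ', sum_eq_zero]
  · simp
  · intro k _
    rw [← smul_sub, ← map_sub, coeff_pow_sub_pow_eq_zero ha hb h _ _ (by omega), smul_zero]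

/-- Every power series with constant term `1` is an exponential. -/
theorem exists_expSeries_eq {r : R⟦X⟧} (hr : coeff 0 r = 1) :
    ∃ a : R⟦X⟧, coeff 0 a = 0 ∧ expSeries a = r := by
  -- `E n` is the logarithm of `r` truncated after degree `n`; each stage adds the current error in
  -- degree `n + 1`, which leaves the lower coefficients fixed.
  let E : ℕ → R⟦X⟧ := fun n => Nat.rec 0
    (fun n e => e + monomial (n + 1) (coeff (n + 1) r - coeff (n + 1) (expSeries e))) n
  have hE (n : ℕ) : E (n + 1) = E n +
      monomial (n + 1) (coeff (n + 1) r - coeff (n + 1) (expSeries (E n))) := rfl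
  have hE0 : E 0 = 0 := rfl
  have hstep (n i : ℕ) (h : i ≠ n + 1) : coeff i (E (n + 1)) = coeff i (E n) := by
    rw [hE, map_add, coeff_monomial, if_neg h, add_zero]
  have hle (n i : ℕ) (h : n < i) : coeff i (E n) = 0 := by
    induction n with
    | zero => simp [hE0]
    | succ n ih => rw [hstep n i (by omega), ih (by omega)]
  have hst (n i : ℕ) (h : i ≤ n) : coeff i (E n) = coeff i (E i) := by
    induction n with
    | zero => rw [Nat.le_zero.1 h]
    | succ n ih =>
      obtain rfl | h := h.eq_or_lt
      · rfl
      · rw [hstep n i (by omega), ih (by omega)]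
  have h00 (n : ℕ) : coeff 0 (E n) = 0 := by rw [hst n 0 n.zero_le, hE0, map_zero]
  refine ⟨PowerSeries.mk fun n => coeff n (E n), by simp [hE0], ?_⟩
  ext n
  have h1 := coeff_expSeries_sub (a := PowerSeries.mk fun n => coeff n (E n)) (b := E n) (n := n)
    (by simp [hE0]) (h00 n) (fun i hi => by rw [coeff_mk, hst n i hi.le])
  rw [coeff_mk, sub_self, sub_eq_zero] at h1
  rw [h1]
  cases n with
  | zero => simp [hE0, expSeries_zero, hr]
  | succ n =>
    have h2 := coeff_expSeries_sub (a := E (n + 1)) (b := E n) (n := n + 1)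
      (h00 (n + 1)) (h00 n) (fun i hi => hstep n i (by omega))
    rw [hle n (n + 1) (by omega), hE, map_add, hle n (n + 1) (by omega), coeff_monomial_same] at h2
    rw [hE]
    simpa using h2

end ExpSeries

/-! ### Coefficientwise images of power series -/

section MapCoeff

variable {A B : Type*} [Ring A] [Algebra ℝ A] [Ring B] [Algebra ℝ B]

/-- The power series obtained by applying a linear map to the coefficients. -/
def mapCoeff (φ : A →ₗ[ℝ] B) (a : A⟦X⟧) : B⟦X⟧ := PowerSeries.mk fun n => φ (coeff n a)

theorem coeff_mapCoeff (φ : A →ₗ[ℝ] B) (a : A⟦X⟧) (n : ℕ) :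
    coeff n (mapCoeff φ a) = φ (coeff n a) := coeff_mk _ _

theorem coeff_zero_mapCoeff (φ : A →ₗ[ℝ] B) {a : A⟦X⟧} (ha : coeff 0 a = 0) :
    coeff 0 (mapCoeff φ a) = 0 := by
  rw [coeff_mapCoeff, ha, map_zero]

theorem mapCoeff_pow {φ : A →ₗ[ℝ] B} (h1 : φ 1 = 1) (hφ : ∀ x y, φ (x * y) = φ x * φ y) (a : A⟦X⟧)
    (k : ℕ) : mapCoeff φ (a ^ k) = mapCoeff φ a ^ k := by
  induction k with
  | zero => ext n; simp [coeff_mapCoeff, coeff_one, apply_ite φ, h1]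
  | succ k ih =>
    ext n
    simp only [pow_succ, ← ih, coeff_mapCoeff, coeff_mul, map_sum, hφ]

/-- Reversing products does not matter for powers of a single series. This is needed because
precomposition is an antihomomorphism. -/
theorem mapCoeff_pow_of_anti {φ : A →ₗ[ℝ] B} (h1 : φ 1 = 1) (hφ : ∀ x y, φ (x * y) = φ y * φ x)
    (a : A⟦X⟧) (k : ℕ) : mapCoeff φ (a ^ k) = mapCoeff φ a ^ k := by
  induction k with
  | zero => ext n; simp [coeff_mapCoeff, coeff_one, apply_ite φ, h1]
  | succ k ih =>
    ext n
    rw [pow_succ' (mapCoeff φ a), pow_succ a, ← ih]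
    simp only [coeff_mapCoeff, coeff_mul, map_sum, hφ]
    exact sum_nbij' Prod.swap Prod.swap (by simp [add_comm]) (by simp [add_comm]) (by simp)
      (by simp) (by simp)

theorem expSeries_mapCoeff {φ : A →ₗ[ℝ] B} {a : A⟦X⟧}
    (h : ∀ k, mapCoeff φ (a ^ k) = mapCoeff φ a ^ k) :
    expSeries (mapCoeff φ a) = mapCoeff φ (expSeries a) := by
  ext n
  simp only [expSeries, coeff_mk, coeff_mapCoeff, ← h, map_sum, map_smul]

theorem commute_mapCoeff {A' : Type*} [Ring A'] [Algebra ℝ A'] {φ : A →ₗ[ℝ] B} {ψ : A' →ₗ[ℝ] B}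
    (h : ∀ x y, Commute (φ x) (ψ y)) (a : A⟦X⟧) (a' : A'⟦X⟧) :
    Commute (mapCoeff φ a) (mapCoeff ψ a') := by
  ext n
  simp only [coeff_mul, coeff_mapCoeff]
  exact sum_nbij' Prod.swap Prod.swap (by simp [add_comm]) (by simp [add_comm]) (by simp)
      (by simp) (fun p _ => h _ _)

end MapCoeff

/-! ### The action of power series of operators on formal series of vectors -/

section Conv

variable {R W : Type*} [Ring R] [AddCommGroup W] [Module R W]

/-- The action of a power series with coefficients in `R` on a formal series in an `R`-module. -/
def conv (a : R⟦X⟧) (w : ℕ → W) : ℕ → W :=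
  fun n => ∑ p ∈ antidiagonal n, coeff p.1 a • w p.2

theorem one_conv (w : ℕ → W) : conv (1 : R⟦X⟧) w = w := by
  funext n
  rw [conv, sum_eq_single (0, n)]
  · simp
  · rintro ⟨i, j⟩ hp hne
    have hi : i ≠ 0 := by
      rintro rfl
      exact hne (by simpa using hp)
    simp [coeff_one, hi]
  · simp

theorem mul_conv (a b : R⟦X⟧) (w : ℕ → W) : conv (a * b) w = conv a (conv b w) := by
  funext n
  simp only [conv, coeff_mul, sum_smul, smul_sum, sum_sigma']
  apply sum_nbij' (fun ⟨⟨_i, j⟩, ⟨k, l⟩⟩ ↦ ⟨(k, l + j), (l, j)⟩)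
    (fun ⟨⟨i, _j⟩, ⟨k, l⟩⟩ ↦ ⟨(i + k, l), (i, k)⟩) <;>
    simp +contextual only [mem_sigma, HasAntidiagonal.mem_antidiagonal, Sigma.forall, Prod.forall,
      mul_smul, and_imp, implies_true]
  all_goals
    rintro a b c d rfl h
    subst h
    simp [add_assoc]

theorem pow_conv (a : R⟦X⟧) (w : ℕ → W) (k : ℕ) : conv (a ^ k) w = (conv a)^[k] w := by
  induction k with
  | zero => rw [pow_zero, one_conv, Function.iterate_zero, id]
  | succ k ih => rw [pow_succ', mul_conv, ih, Function.iterate_succ_apply']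

theorem conv_single (a : R⟦X⟧) (w : W) (n : ℕ) :
    conv a (fun k => if k = 0 then w else 0) n = coeff n a • w := by
  rw [conv, sum_eq_single (n, 0)]
  · simp
  · rintro ⟨i, j⟩ hp hne
    have hj : j ≠ 0 := by
      rintro rfl
      exact hne (by simpa using hp)
    simp [hj]
  · simp

theorem conv_expSeries [Algebra ℝ R] [Module ℝ W] [IsScalarTower ℝ R W] {a : R⟦X⟧}
    (ha : coeff 0 a = 0) (w : ℕ → W) (n : ℕ) :
    conv (expSeries a) w n =
      ∑ k ∈ range (n + 1), (k.factorial : ℝ)⁻¹ • (conv a)^[k] w n := by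
  simp only [← pow_conv, conv, smul_sum]
  rw [sum_comm]
  refine sum_congr rfl fun p hp => ?_
  rw [coeff_expSeries ha (N := n) (by have := HasAntidiagonal.mem_antidiagonal.1 hp; omega),
    sum_smul]
  simp only [smul_assoc]

end Conv

/-! ### Operators on bilinear maps -/

section Bilinear

/-- Linear operators on the space of bilinear maps `Γ × Γ → Γ`. -/
def BilinOp (Γ : Type*) [AddCommGroup Γ] [Module ℝ Γ] : Type _ :=
  Module.End ℝ (Γ →ₗ[ℝ] Γ →ₗ[ℝ] Γ)

variable (A Γ : Type*) [Ring A] [Algebra ℝ A] [AddCommGroup Γ] [Module ℝ Γ]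

instance : Ring (BilinOp Γ) := inferInstanceAs (Ring (Module.End ℝ _))

instance : Algebra ℝ (BilinOp Γ) := inferInstanceAs (Algebra ℝ (Module.End ℝ _))

instance : Module (BilinOp Γ) (Γ →ₗ[ℝ] Γ →ₗ[ℝ] Γ) := inferInstanceAs (Module (Module.End ℝ _) _)

instance : IsScalarTower ℝ (BilinOp Γ) (Γ →ₗ[ℝ] Γ →ₗ[ℝ] Γ) :=
  inferInstanceAs (IsScalarTower ℝ (Module.End ℝ _) _)

variable [Module A Γ] [IsScalarTower ℝ A Γ]

/-- Postcomposition of bilinear maps with a scalar. -/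
def postcomp : A →ₗ[ℝ] BilinOp Γ where
  toFun a :=
    { toFun := fun w => w.compr₂ (Algebra.lsmul ℝ ℝ Γ a)
      map_add' := fun _ _ => by ext; simp
      map_smul' := fun _ _ => by ext; simp }
  map_add' a b := LinearMap.ext fun w => LinearMap.ext₂ fun X Y => add_smul a b (w X Y)
  map_smul' c a := LinearMap.ext fun w => LinearMap.ext₂ fun X Y => smul_assoc c a (w X Y)

/-- Precomposition of bilinear maps with a scalar in the first argument. -/
def precompFst : A →ₗ[ℝ] BilinOp Γ where
  toFun a :=
    { toFun := fun w => w ∘ₗ Algebra.lsmul ℝ ℝ Γ a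
      map_add' := fun _ _ => rfl
      map_smul' := fun _ _ => rfl }
  map_add' a b := LinearMap.ext fun w => LinearMap.ext₂ fun X Y =>
    show w ((a + b) • X) Y = w (a • X) Y + w (b • X) Y by
      rw [add_smul, map_add, LinearMap.add_apply]
  map_smul' c a := LinearMap.ext fun w => LinearMap.ext₂ fun X Y =>
    show w ((c • a) • X) Y = c • w (a • X) Y by
      rw [smul_assoc, map_smul, LinearMap.smul_apply]

/-- Precomposition of bilinear maps with a scalar in the second argument. -/
def precompSnd : A →ₗ[ℝ] BilinOp Γ where
  toFun a :=
    { toFun := fun w => w.compl₂ (Algebra.lsmul ℝ ℝ Γ a)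
      map_add' := fun _ _ => rfl
      map_smul' := fun _ _ => rfl }
  map_add' a b := LinearMap.ext fun w => LinearMap.ext₂ fun X Y =>
    show w X ((a + b) • Y) = w X (a • Y) + w X (b • Y) by rw [add_smul, map_add]
  map_smul' c a := LinearMap.ext fun w => LinearMap.ext₂ fun X Y =>
    show w X ((c • a) • Y) = c • w X (a • Y) by rw [smul_assoc, map_smul]

variable {A Γ}

theorem postcomp_apply (a : A) (w : Γ →ₗ[ℝ] Γ →ₗ[ℝ] Γ) (X Y : Γ) :
    (postcomp A Γ a • w) X Y = a • w X Y := rfl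

theorem precompFst_apply (a : A) (w : Γ →ₗ[ℝ] Γ →ₗ[ℝ] Γ) (X Y : Γ) :
    (precompFst A Γ a • w) X Y = w (a • X) Y := rfl

theorem precompSnd_apply (a : A) (w : Γ →ₗ[ℝ] Γ →ₗ[ℝ] Γ) (X Y : Γ) :
    (precompSnd A Γ a • w) X Y = w X (a • Y) := rfl

theorem bilinOp_ext {f g : BilinOp Γ}
    (h : ∀ (w : Γ →ₗ[ℝ] Γ →ₗ[ℝ] Γ) (X Y : Γ), (f • w) X Y = (g • w) X Y) : f = g :=
  LinearMap.ext fun w => LinearMap.ext₂ (h w)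

/-- The operator `ad_D` on formal series of bilinear maps, as a series of operators. -/
def adOp (Γ : Type*) [AddCommGroup Γ] [Module ℝ Γ] [Module A Γ] [IsScalarTower ℝ A Γ] (D : A⟦X⟧) :
    (BilinOp Γ)⟦X⟧ :=
  mapCoeff (postcomp A Γ) D - (mapCoeff (precompFst A Γ) D + mapCoeff (precompSnd A Γ) D)

theorem coeff_adOp_smul (D : A⟦X⟧) (n : ℕ) (w : Γ →ₗ[ℝ] Γ →ₗ[ℝ] Γ) (X Y : Γ) :
    (coeff n (adOp Γ D) • w) X Y =
      coeff n D • w X Y - (w (coeff n D • X) Y + w X (coeff n D • Y)) := by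
  rw [adOp, map_sub, map_add, coeff_mapCoeff, coeff_mapCoeff, coeff_mapCoeff, sub_smul, add_smul]
  rfl

theorem coeff_zero_adOp {D : A⟦X⟧} (hD : coeff 0 D = 0) : coeff 0 (adOp Γ D) = 0 := by
  rw [adOp, map_sub, map_add, coeff_zero_mapCoeff _ hD, coeff_zero_mapCoeff _ hD,
    coeff_zero_mapCoeff _ hD, add_zero, sub_zero]

theorem commute_postcomp_precompFst (D : A⟦X⟧) :
    Commute (mapCoeff (postcomp A Γ) D) (mapCoeff (precompFst A Γ) D) :=
  commute_mapCoeff (fun x y => (commute_iff_eq _ _).2 <| bilinOp_ext fun w X Y => by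
    simp only [mul_smul, postcomp_apply, precompFst_apply]) _ _

theorem commute_postcomp_precompSnd (D : A⟦X⟧) :
    Commute (mapCoeff (postcomp A Γ) D) (mapCoeff (precompSnd A Γ) D) :=
  commute_mapCoeff (fun x y => (commute_iff_eq _ _).2 <| bilinOp_ext fun w X Y => by
    simp only [mul_smul, postcomp_apply, precompSnd_apply]) _ _

theorem commute_precompFst_precompSnd (D : A⟦X⟧) :
    Commute (mapCoeff (precompFst A Γ) D) (mapCoeff (precompSnd A Γ) D) :=
  commute_mapCoeff (fun x y => (commute_iff_eq _ _).2 <| bilinOp_ext fun w X Y => by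
    simp only [mul_smul, precompFst_apply, precompSnd_apply]) _ _

theorem expSeries_postcomp (D : A⟦X⟧) :
    expSeries (mapCoeff (postcomp A Γ) D) = mapCoeff (postcomp A Γ) (expSeries D) :=
  expSeries_mapCoeff (mapCoeff_pow
    (bilinOp_ext fun w X Y => by rw [postcomp_apply, one_smul, one_smul])
    (fun x y => bilinOp_ext fun w X Y => by simp only [mul_smul, postcomp_apply]) D)

theorem expSeries_precompFst (D : A⟦X⟧) :
    expSeries (mapCoeff (precompFst A Γ) D) = mapCoeff (precompFst A Γ) (expSeries D) :=
  expSeries_mapCoeff (mapCoeff_pow_of_anti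
    (bilinOp_ext fun w X Y => by rw [precompFst_apply, one_smul, one_smul])
    (fun x y => bilinOp_ext fun w X Y => by simp only [mul_smul, precompFst_apply]) D)

theorem expSeries_precompSnd (D : A⟦X⟧) :
    expSeries (mapCoeff (precompSnd A Γ) D) = mapCoeff (precompSnd A Γ) (expSeries D) :=
  expSeries_mapCoeff (mapCoeff_pow_of_anti
    (bilinOp_ext fun w X Y => by rw [precompSnd_apply, one_smul, one_smul])
    (fun x y => bilinOp_ext fun w X Y => by simp only [mul_smul, precompSnd_apply]) D)

/-- Postcomposition is the sum of the two precompositions and `ad_D`, and these two summands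
commute. -/
theorem expSeries_postcomp_eq_mul {D : A⟦X⟧} (hD : coeff 0 D = 0) :
    expSeries (mapCoeff (postcomp A Γ) D) =
      expSeries (mapCoeff (precompFst A Γ) D + mapCoeff (precompSnd A Γ) D) *
        expSeries (adOp Γ D) := by
  rw [← expSeries_add _ (coeff_zero_adOp hD)]
  · rw [adOp, add_sub_cancel]
  · exact ((commute_postcomp_precompFst D).add_right
      (commute_postcomp_precompSnd D)).symm.sub_right (Commute.refl _)
  · rw [map_add, coeff_zero_mapCoeff _ hD, coeff_zero_mapCoeff _ hD, add_zero]

/-- The hypothesis `h` reads `e^D m(X, Y) = m₀(e^D X, e^D Y)`. With `L` postcomposition and `R` the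
sum of the precompositions, it says `exp(L) m = exp(R) m₀`. Since `exp(L) = exp(R) exp(ad_D)`, the
invertible factor `exp(R)` cancels. -/
theorem conv_expSeries_adOp {D : A⟦X⟧} (hD : coeff 0 D = 0)
    (m : ℕ → Γ →ₗ[ℝ] Γ →ₗ[ℝ] Γ) (m₀ : Γ →ₗ[ℝ] Γ →ₗ[ℝ] Γ)
    (h : ∀ n X Y, ∑ p ∈ antidiagonal n, coeff p.1 (expSeries D) • m p.2 X Y =
      ∑ p ∈ antidiagonal n, m₀ (coeff p.1 (expSeries D) • X) (coeff p.2 (expSeries D) • Y)) :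
    conv (expSeries (adOp Γ D)) m = fun k => if k = 0 then m₀ else 0 := by
  have hR₁ : coeff 0 (mapCoeff (precompFst A Γ) D) = 0 := coeff_zero_mapCoeff _ hD
  have hR₂ : coeff 0 (mapCoeff (precompSnd A Γ) D) = 0 := coeff_zero_mapCoeff _ hD
  have hR : coeff 0 (mapCoeff (precompFst A Γ) D + mapCoeff (precompSnd A Γ) D) = 0 := by
    rw [map_add, hR₁, hR₂, add_zero]
  have key : conv (expSeries (mapCoeff (precompFst A Γ) D + mapCoeff (precompSnd A Γ) D))
        (conv (expSeries (adOp Γ D)) m) =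
      conv (expSeries (mapCoeff (precompFst A Γ) D + mapCoeff (precompSnd A Γ) D))
        (fun k => if k = 0 then m₀ else 0) := by
    rw [← mul_conv, ← expSeries_postcomp_eq_mul hD]
    funext n
    rw [conv_single, expSeries_add hR₁ hR₂ (commute_precompFst_precompSnd D), expSeries_postcomp,
      expSeries_precompFst, expSeries_precompSnd]
    refine LinearMap.ext₂ fun X Y => ?_
    simpa only [conv, coeff_mul, coeff_mapCoeff, LinearMap.sum_apply, sum_smul, mul_smul,
      postcomp_apply, precompFst_apply, precompSnd_apply] using h n X Y
  have := congrArg (conv (expSeries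
    (-(mapCoeff (precompFst A Γ) D + mapCoeff (precompSnd A Γ) D)))) key
  rwa [← mul_conv, ← mul_conv, expSeries_neg_mul hR, one_mul, ← mul_conv, expSeries_neg_mul hR,
    one_conv] at this

end Bilinear

/-! ### Low-degree brackets -/

section LowDegree

variable {Γ : Type*} [AddCommGroup Γ]

theorem gerstenhaber_zero_one (D : (Fin (0 + 1) → Γ) → Γ) (m : (Fin (1 + 1) → Γ) → Γ)
    (s : Fin (1 + 1) → Γ) :
    gerstenhaber (p := 0) (q := 1) (n := 1) rfl D m s = D ![m ![s 0, s 1]] := by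
  have h : (univ.filter fun τ : Equiv.Perm (Fin (1 + 1)) => IsShuffle (1 + 1) τ) = {1} := by
    decide
  rw [gerstenhaber, h, sum_singleton]
  simp only [Equiv.Perm.sign_one, Units.val_one, one_smul]
  congr 1
  funext i
  fin_cases i
  simp only [Fin.zero_eta, Fin.cons_zero, Matrix.cons_val_zero]
  congr 1
  funext i
  fin_cases i <;> rfl

theorem gerstenhaber_one_zero (D : (Fin (0 + 1) → Γ) → Γ) (m : (Fin (1 + 1) → Γ) → Γ)
    (s : Fin (1 + 1) → Γ) :
    gerstenhaber (p := 1) (q := 0) (n := 1) rfl m D s =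
      m ![D ![s 0], s 1] - m ![D ![s 1], s 0] := by
  have h : (univ.filter fun τ : Equiv.Perm (Fin (1 + 1)) => IsShuffle (0 + 1) τ) =
      {1, Equiv.swap 0 1} := by
    decide
  rw [gerstenhaber, h, sum_pair (by decide)]
  rw [sub_eq_add_neg]
  congr 1
  · simp only [Equiv.Perm.sign_one, Units.val_one, one_smul]
    congr 1
    funext i
    fin_cases i
    · exact congrArg D (funext fun i => by fin_cases i; rfl)
    · rfl
  · rw [Equiv.Perm.sign_swap (by decide), Units.val_neg, Units.val_one, neg_smul, one_smul]
    congr 2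
    funext i
    fin_cases i
    · exact congrArg D (funext fun i => by fin_cases i; rfl)
    · rfl

/-- The three permutations are the `(2, 1)`-shuffles, indexed by the argument left outside the inner
bracket. -/
theorem gerstenhaber_one_one (m m' : (Fin (1 + 1) → Γ) → Γ) (X Y Z : Γ) :
    gerstenhaber (p := 1) (q := 1) (n := 2) rfl m m' ![X, Y, Z] =
      m ![m' ![X, Y], Z] - m ![m' ![X, Z], Y] + m ![m' ![Y, Z], X] := by
  have h : (univ.filter fun τ : Equiv.Perm (Fin (2 + 1)) => IsShuffle (1 + 1) τ) =
      {1, Equiv.swap 1 2, Equiv.swap 0 1 * Equiv.swap 1 2} := by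
    decide
  have hs : ((Equiv.Perm.sign (Equiv.swap 0 1 * Equiv.swap 1 2 : Equiv.Perm (Fin (2 + 1)))
      : ℤˣ) : ℤ) = 1 := by decide
  have hs' : ((Equiv.Perm.sign (Equiv.swap 1 2 : Equiv.Perm (Fin (2 + 1)))
      : ℤˣ) : ℤ) = -1 := by decide
  rw [gerstenhaber, h, sum_insert (by decide), sum_pair (by decide), hs, hs', sub_eq_add_neg,
    add_assoc]
  simp only [Equiv.Perm.sign_one, Units.val_one, one_smul, neg_smul]
  congr 1
  · congr 1
    funext i
    fin_cases i
    · exact congrArg m' (funext fun i => by fin_cases i <;> rfl)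
    · rfl
  congr 1
  · congr 2
    funext i
    fin_cases i
    · exact congrArg m' (funext fun i => by fin_cases i <;> rfl)
    · rfl
  · congr 1
    funext i
    fin_cases i
    · exact congrArg m' (funext fun i => by fin_cases i <;> rfl)
    · rfl

end LowDegree

/-! ### Degree-one brackets as bilinear maps, and the adjoint action on their series -/

section Series

variable {Γ : Type*} [AddCommGroup Γ] [Module ℝ Γ]

theorem map_pair_swap (m : Γ [⋀^Fin (1 + 1)]→ₗ[ℝ] Γ) (X Y : Γ) : m ![X, Y] = -m ![Y, X] := by
  rw [← m.map_swap ![Y, X] (i := 0) (j := 1) (by decide)]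
  congr 1
  funext i
  fin_cases i <;> rfl

/-- An alternating map of degree one as a bilinear map. -/
def toBilin (m : Γ [⋀^Fin (1 + 1)]→ₗ[ℝ] Γ) : Γ →ₗ[ℝ] Γ →ₗ[ℝ] Γ :=
  LinearMap.mk₂ ℝ (fun X Y => m ![X, Y]) (fun _ _ _ => m.map_vecCons_add _ _ _)
    (fun _ _ _ => m.map_vecCons_smul _ _ _)
    (fun X Y Y' => by
      rw [map_pair_swap, m.map_vecCons_add, neg_add, ← map_pair_swap, ← map_pair_swap])
    (fun c X Y => by rw [map_pair_swap, m.map_vecCons_smul, ← smul_neg, ← map_pair_swap])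

theorem toBilin_apply (m : Γ [⋀^Fin (1 + 1)]→ₗ[ℝ] Γ) (X Y : Γ) : toBilin m X Y = m ![X, Y] := rfl

theorem toBilin_swap (m : Γ [⋀^Fin (1 + 1)]→ₗ[ℝ] Γ) (X Y : Γ) :
    toBilin m X Y = -toBilin m Y X :=
  map_pair_swap m X Y

theorem apply_eq_toBilin (m : Γ [⋀^Fin (1 + 1)]→ₗ[ℝ] Γ) (s : Fin (1 + 1) → Γ) :
    m s = toBilin m (s 0) (s 1) :=
  congrArg m (funext fun i => by fin_cases i <;> rfl)

variable {A : Type*} [Ring A] [Algebra ℝ A] [Module A Γ] [IsScalarTower ℝ A Γ]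

/-- Shuffles insert `D` only into the first slot of `w`; antisymmetry turns `-w(D Y, X)` into the
term `w(X, D Y)` of `adOp`. -/
theorem adSeries_eq_conv_adOp (D : A⟦X⟧) (w : ℕ → Γ →ₗ[ℝ] Γ →ₗ[ℝ] Γ)
    (hw : ∀ n X Y, w n X Y = -w n Y X) :
    adSeries (q := 1) (fun n s => coeff n D • s 0) (fun n s => w n (s 0) (s 1)) =
      fun n s => conv (adOp Γ D) w n (s 0) (s 1) := by
  funext n s
  simp only [adSeries, cmBracketSeries, Finset.sum_apply, conv, LinearMap.sum_apply]
  refine sum_congr rfl fun p _ => ?_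
  rw [cmBracket, gerstenhaber_zero_one, gerstenhaber_one_zero, coeff_adOp_smul,
    hw p.2 (s 0) (coeff p.1 D • s 1), zero_mul, pow_zero, one_smul, ← sub_eq_add_neg]
  rfl

theorem conv_adOp_swap (D : A⟦X⟧) {w : ℕ → Γ →ₗ[ℝ] Γ →ₗ[ℝ] Γ}
    (hw : ∀ n X Y, w n X Y = -w n Y X) (n : ℕ) (X Y : Γ) :
    conv (adOp Γ D) w n X Y = -conv (adOp Γ D) w n Y X := by
  simp only [conv, LinearMap.sum_apply, ← sum_neg_distrib, coeff_adOp_smul]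
  refine sum_congr rfl fun p _ => ?_
  rw [hw p.2 X Y, hw p.2 (coeff p.1 D • X), hw p.2 X, smul_neg]
  abel

/-- Antisymmetry is carried through the induction because each further application of `ad_D`
requires it. -/
theorem iterate_adSeries_eq (D : A⟦X⟧) (w : ℕ → Γ →ₗ[ℝ] Γ →ₗ[ℝ] Γ)
    (hw : ∀ n X Y, w n X Y = -w n Y X) (k : ℕ) :
    (∀ n X Y, (conv (adOp Γ D))^[k] w n X Y = -(conv (adOp Γ D))^[k] w n Y X) ∧
    (adSeries (q := 1) (fun n s => coeff n D • s 0))^[k] (fun n s => w n (s 0) (s 1)) =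
      fun n s => (conv (adOp Γ D))^[k] w n (s 0) (s 1) := by
  induction k with
  | zero => exact ⟨hw, rfl⟩
  | succ k ih =>
    simp only [Function.iterate_succ_apply']
    exact ⟨conv_adOp_swap D ih.1, by rw [ih.2, adSeries_eq_conv_adOp D _ ih.1]⟩

theorem expAd_eq_conv {D : A⟦X⟧} (hD : coeff 0 D = 0) (m : ℕ → Γ [⋀^Fin (1 + 1)]→ₗ[ℝ] Γ) :
    expAd (fun n s => coeff n D • s 0) (fun i => ⇑(m i)) =
      fun n s => conv (expSeries (adOp Γ D)) (fun i => toBilin (m i)) n (s 0) (s 1) := by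
  have hm : (fun i => ⇑(m i)) = fun i s => toBilin (m i) (s 0) (s 1) := by
    funext i s
    exact apply_eq_toBilin _ _
  funext n s
  rw [expAd, hm, conv_expSeries (coeff_zero_adOp hD)]
  simp only [Finset.sum_apply, LinearMap.sum_apply, Pi.smul_apply, LinearMap.smul_apply]
  refine sum_congr rfl fun k _ => ?_
  rw [(iterate_adSeries_eq D _ (fun n => toBilin_swap (m n)) k).2]

/-- A series of brackets that is conjugate to `m₀` by a series of operators `1 + t r₁ + ⋯` is
equivalent to `m₀`. -/
theorem exists_expAd_eq {r : ℕ → A} (hr : r 0 = 1) (m : ℕ → Γ [⋀^Fin (1 + 1)]→ₗ[ℝ] Γ)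
    (m₀ : Γ [⋀^Fin (1 + 1)]→ₗ[ℝ] Γ)
    (h : ∀ n X Y, ∑ p ∈ antidiagonal n, r p.1 • toBilin (m p.2) X Y =
      ∑ p ∈ antidiagonal n, toBilin m₀ (r p.1 • X) (r p.2 • Y)) :
    ∃ D : ℕ → A, D 0 = 0 ∧ ∀ n, expAd (fun n s => D n • s 0) (fun i => ⇑(m i)) n =
      ⇑(if n = 0 then m₀ else 0) := by
  obtain ⟨D, hD, hDr⟩ := exists_expSeries_eq (r := PowerSeries.mk r) (by rw [coeff_mk, hr])
  refine ⟨fun n => coeff n D, hD, fun n => ?_⟩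
  rw [expAd_eq_conv hD, conv_expSeries_adOp hD _ (toBilin m₀)
    (by simpa only [hDr, coeff_mk] using h)]
  funext s
  dsimp only
  split_ifs with hn
  · exact (apply_eq_toBilin m₀ s).symm
  · rfl

/-- In degrees `p = q = 1` the sign is `-1`, so after exchanging the two indices the coefficient of
`[m_t, m_t]` is `-2` times that of `m_t ∘ m_t`, and `2` is invertible. -/
theorem sum_jacobi_eq_zero {m : ℕ → Γ [⋀^Fin (1 + 1)]→ₗ[ℝ] Γ} {k : ℕ}
    (h : cmBracketSeries (n := 2) rfl (fun i => ⇑(m i)) (fun i => ⇑(m i)) k = 0) (X Y Z : Γ) :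
    ∑ p ∈ antidiagonal k, (toBilin (m p.1) (toBilin (m p.2) X Y) Z -
      toBilin (m p.1) (toBilin (m p.2) X Z) Y + toBilin (m p.1) (toBilin (m p.2) Y Z) X) = 0 := by
  have h := congrFun h ![X, Y, Z]
  simp only [cmBracketSeries, Finset.sum_apply, cmBracket, gerstenhaber_one_one,
    Pi.zero_apply, sum_sub_distrib] at h
  set S := ∑ p ∈ antidiagonal k, (toBilin (m p.1) (toBilin (m p.2) X Y) Z -
      toBilin (m p.1) (toBilin (m p.2) X Z) Y + toBilin (m p.1) (toBilin (m p.2) Y Z) X) with hS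
  have h1 : ∑ p ∈ antidiagonal k, (-1 : ℤ) ^ (1 * 1) • (m p.1 ![m p.2 ![X, Y], Z] -
      m p.1 ![m p.2 ![X, Z], Y] + m p.1 ![m p.2 ![Y, Z], X]) = -S := by
    rw [hS, ← sum_neg_distrib]
    refine sum_congr rfl fun p _ => ?_
    simp only [toBilin_apply]
    rw [one_mul, pow_one, neg_smul, one_smul]
  have h2 : ∑ p ∈ antidiagonal k, (m p.2 ![m p.1 ![X, Y], Z] -
      m p.2 ![m p.1 ![X, Z], Y] + m p.2 ![m p.1 ![Y, Z], X]) = S :=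
    sum_nbij' Prod.swap Prod.swap (by simp [add_comm]) (by simp [add_comm]) (by simp)
      (by simp) (fun p _ => rfl)
  rw [h1, h2] at h
  have h3 : (2 : ℝ) • S = 0 := by
    rw [two_smul, ← neg_eq_zero, neg_add, ← sub_eq_add_neg]
    exact h
  simpa using h3

end Series

/-! ### Vector fields on a manifold and their action on functions -/

section Geometry

variable {d : ℕ} {M : Type*} [TopologicalSpace M] [ChartedSpace (EuclideanSpace ℝ (Fin d)) M]
  [IsManifold (𝓡 d) ∞ M]

/-- The derivative of a smooth function along a vector field, as a smooth function. -/
def lieDeriv (X : VectorFields d M) (f : C^∞⟮𝓡 d, M; ℝ⟯) : C^∞⟮𝓡 d, M; ℝ⟯ :=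
  ⟨X.applyFun f, (contMDiff_snd_tangentBundle_modelSpace ℝ 𝓘(ℝ, ℝ)).comp
    ((f.contMDiff.contMDiff_tangentMap (m := ∞) (by simp)).comp X.contMDiff)⟩

theorem lieDeriv_apply (X : VectorFields d M) (f : C^∞⟮𝓡 d, M; ℝ⟯) (x : M) :
    lieDeriv X f x = mvfderiv (𝓡 d) f x (X x) := rfl

/-- A local smooth extension of `v` is multiplied by a bump function supported where the extension
is smooth. -/
theorem exists_vectorField_apply_eq [T2Space M] {x : M} (v : TangentSpace (𝓡 d) x) :
    ∃ X : VectorFields d M, X x = v := by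
  obtain ⟨s, hs, hsm⟩ := FiberBundle.exists_contMDiffOn_extend (k := ∞) (V := TangentSpace (𝓡 d))
    (𝓡 d) (EuclideanSpace ℝ (Fin d)) v
  obtain ⟨b, -, hb⟩ := (SmoothBumpFunction.nhds_basis_tsupport (I := 𝓡 d) x).mem_iff.1
    (interior_mem_nhds.2 hs)
  refine ⟨⟨_, ContMDiffOn.smul_section_of_tsupport b.contMDiff.contMDiffOn isOpen_interior hb
    (hsm.mono interior_subset)⟩, ?_⟩
  change b x • _ = v
  simp

/-- The test functions are the coordinates of the chart at `x`, cut off by a bump function equal to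
`1` near `x`; the derivative of that chart at `x` is the identity. -/
theorem eq_zero_of_forall_mvfderiv [T2Space M] {x : M} {v : TangentSpace (𝓡 d) x}
    (h : ∀ f : C^∞⟮𝓡 d, M; ℝ⟯, mvfderiv (𝓡 d) f x v = 0) : v = 0 := by
  obtain ⟨b⟩ : Nonempty (SmoothBumpFunction (𝓡 d) x) := inferInstance
  have hb : ContMDiff (𝓡 d) 𝓘(ℝ, EuclideanSpace ℝ (Fin d)) ∞ fun y => b y • extChartAt (𝓡 d) x y :=
    b.contMDiff_smul contMDiffOn_extChartAt
  have hev : (fun y => b y • extChartAt (𝓡 d) x y) =ᶠ[nhds x] extChartAt (𝓡 d) x := by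
    filter_upwards [b.eventuallyEq_one] with y hy
    rw [hy, Pi.one_apply, one_smul]
  have hd : HasMFDerivAt (𝓡 d) 𝓘(ℝ, EuclideanSpace ℝ (Fin d))
      (fun y => b y • extChartAt (𝓡 d) x y) x (ContinuousLinearMap.id ℝ _) := by
    have := (hb.mdifferentiable (by simp) x).hasMFDerivAt
    rwa [hev.mfderiv_eq, mfderiv_extChartAt_self] at this
  refine PiLp.ext fun i => ?_
  let p : EuclideanSpace ℝ (Fin d) →L[ℝ] ℝ := EuclideanSpace.proj i
  have hp := (p.hasFDerivAt (x := b x • extChartAt (𝓡 d) x x)).hasMFDerivAt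
  have := h ⟨_, p.contDiff.contMDiff.comp hb⟩
  rw [mvfderiv] at this
  have e := (hp.comp x hd).mfderiv
  have e' := congrArg (fun L => L v) e
  exact e'.symm.trans this

theorem vectorField_apply_eq_of_lieDeriv [T2Space M] {X Y : VectorFields d M} {x : M}
    (h : ∀ f, lieDeriv X f x = lieDeriv Y f x) : X x = Y x :=
  sub_eq_zero.1 <| eq_zero_of_forall_mvfderiv fun f => by
    rw [map_sub, ← lieDeriv_apply, ← lieDeriv_apply, h, sub_self]

theorem lieDeriv_add_left (X Y : VectorFields d M) (f : C^∞⟮𝓡 d, M; ℝ⟯) (x : M) :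
    lieDeriv (X + Y) f x = lieDeriv X f x + lieDeriv Y f x :=
  map_add (mvfderiv (𝓡 d) f x) (X x) (Y x)

theorem lieDeriv_smul_left (c : ℝ) (X : VectorFields d M) (f : C^∞⟮𝓡 d, M; ℝ⟯) (x : M) :
    lieDeriv (c • X) f x = c * lieDeriv X f x :=
  map_smul (mvfderiv (𝓡 d) f x) c (X x)

theorem lieDeriv_funSMul_left (g : C^∞⟮𝓡 d, M; ℝ⟯) (X : VectorFields d M) (f : C^∞⟮𝓡 d, M; ℝ⟯)
    (x : M) : lieDeriv (funSMul g X) f x = g x * lieDeriv X f x :=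
  map_smul (mvfderiv (𝓡 d) f x) (g x) (X x)

theorem sum_vectorField_apply {ι : Type*} (s : Finset ι) (X : ι → VectorFields d M) (x : M) :
    (∑ i ∈ s, X i) x = ∑ i ∈ s, X i x := by
  have := congrFun (map_sum (ContMDiffSection.coeAddHom (𝓡 d) (EuclideanSpace ℝ (Fin d)) ∞
    (fun x : M => TangentSpace (𝓡 d) x)) X s) x
  rwa [Finset.sum_apply] at this

theorem lieDeriv_sum_left {ι : Type*} (s : Finset ι) (X : ι → VectorFields d M)
    (f : C^∞⟮𝓡 d, M; ℝ⟯) (x : M) : lieDeriv (∑ i ∈ s, X i) f x = ∑ i ∈ s, lieDeriv (X i) f x := by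
  rw [lieDeriv_apply, sum_vectorField_apply, map_sum]
  rfl

/-! ### Symbols -/

/-- The map `σ` is a symbol of the bracket `m`. -/
def HasSymbol (m : (VectorFields d M) [⋀^Fin (1 + 1)]→ₗ[ℝ] (VectorFields d M))
    (σ : VectorFields d M → VectorFields d M) : Prop :=
  ∀ (X : VectorFields d M) (f : C^∞⟮𝓡 d, M; ℝ⟯) (Y : VectorFields d M),
    toBilin m X (funSMul f Y) = funSMul f (toBilin m X Y) + funSMul (lieDeriv (σ X) f) Y

theorem exists_hasSymbol {m : (VectorFields d M) [⋀^Fin (1 + 1)]→ₗ[ℝ] (VectorFields d M)}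
    (hm : IsMultiderivation m) : ∃ σ, HasSymbol m σ := by
  obtain ⟨σ, hσ⟩ := hm
  have hs (X Y : VectorFields d M) :
      (Fin.snoc (α := fun _ => VectorFields d M) (fun _ : Fin 1 => X) Y) = ![X, Y] := by
    funext i
    fin_cases i <;> rfl
  refine ⟨fun X => σ fun _ => X, fun X f Y => ContMDiffSection.ext fun x => ?_⟩
  have h := hσ (fun _ => X) f Y x
  rw [hs, hs] at h
  exact h

theorem hasSymbol_tangentBracket :
    HasSymbol (tangentBracket d M) id := fun X f Y =>
  ContMDiffSection.ext fun x => (tangentLieAlgebroid d M).leibniz X f Y x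

section Symbol

variable {m : (VectorFields d M) [⋀^Fin (1 + 1)]→ₗ[ℝ] (VectorFields d M)}
  {σ : VectorFields d M → VectorFields d M}

theorem HasSymbol.apply (h : HasSymbol m σ) (X : VectorFields d M) (f : C^∞⟮𝓡 d, M; ℝ⟯)
    (Y : VectorFields d M) (x : M) : toBilin m X (funSMul f Y) x =
      f x • toBilin m X Y x + lieDeriv (σ X) f x • Y x := by
  rw [h X f Y]
  rfl

theorem HasSymbol.lieDeriv_smul (h : HasSymbol m σ) (X : VectorFields d M)
    (f : C^∞⟮𝓡 d, M; ℝ⟯) (Y : VectorFields d M) (x : M) :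
    lieDeriv (σ X) f x • Y x = toBilin m X (funSMul f Y) x - f x • toBilin m X Y x := by
  rw [h.apply, add_sub_cancel_left]

theorem exists_vectorField_apply_ne_zero [T2Space M] [NeZero d] (x : M) :
    ∃ Z : VectorFields d M, Z x ≠ 0 := by
  obtain ⟨v, hv⟩ := exists_ne (0 : EuclideanSpace ℝ (Fin d))
  obtain ⟨Z, hZ⟩ := exists_vectorField_apply_eq (x := x) v
  exact ⟨Z, hZ ▸ hv⟩

/-- Positive dimension enters here: a nonzero tangent vector lets one read a symbol off the Leibniz
rule. -/
theorem eq_of_forall_smul_eq [T2Space M] [NeZero d] (x : M) {a b : ℝ}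
    (h : ∀ Z : VectorFields d M, a • Z x = b • Z x) : a = b := by
  obtain ⟨Z, hZ⟩ := exists_vectorField_apply_ne_zero (d := d) x
  exact smul_left_injective ℝ hZ (h Z)

theorem HasSymbol.map_add [T2Space M] [NeZero d] (h : HasSymbol m σ) (X Y : VectorFields d M) :
    σ (X + Y) = σ X + σ Y := by
  ext1 x
  refine vectorField_apply_eq_of_lieDeriv fun f =>
    eq_of_forall_smul_eq (d := d) x fun Z => ?_
  rw [lieDeriv_add_left, add_smul, h.lieDeriv_smul, h.lieDeriv_smul, h.lieDeriv_smul,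
    _root_.map_add, LinearMap.add_apply, LinearMap.add_apply, ContMDiffSection.coe_add,
    ContMDiffSection.coe_add, Pi.add_apply, Pi.add_apply, smul_add]
  abel

theorem HasSymbol.map_smul [T2Space M] [NeZero d] (h : HasSymbol m σ) (c : ℝ)
    (X : VectorFields d M) : σ (c • X) = c • σ X := by
  ext1 x
  refine vectorField_apply_eq_of_lieDeriv fun f =>
    eq_of_forall_smul_eq (d := d) x fun Z => ?_
  rw [lieDeriv_smul_left, mul_smul, h.lieDeriv_smul, h.lieDeriv_smul,
    _root_.map_smul, LinearMap.smul_apply, LinearMap.smul_apply, ContMDiffSection.coe_smul,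
    ContMDiffSection.coe_smul, Pi.smul_apply, Pi.smul_apply, smul_sub, smul_comm c (f x)]

theorem HasSymbol.unique [T2Space M] [NeZero d] {σ' : VectorFields d M → VectorFields d M}
    (h : HasSymbol m σ) (h' : HasSymbol m σ') (X : VectorFields d M) : σ X = σ' X := by
  ext1 x
  refine vectorField_apply_eq_of_lieDeriv fun f =>
    eq_of_forall_smul_eq (d := d) x fun Z => ?_
  rw [h.lieDeriv_smul, h'.lieDeriv_smul]

/-- Both sides come from expanding `m(f X, g Y)` by the Leibniz rule in either order; the defect of
linearity of `σ` is what fails to cancel. -/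
theorem HasSymbol.defect_smul_eq (h : HasSymbol m σ) (X Y : VectorFields d M)
    (f g : C^∞⟮𝓡 d, M; ℝ⟯) (x : M) :
    lieDeriv (σ (funSMul f X) - funSMul f (σ X)) g x • Y x =
      -(lieDeriv (σ (funSMul g Y) - funSMul g (σ Y)) f x • X x) := by
  have e (V W : VectorFields d M) (k : C^∞⟮𝓡 d, M; ℝ⟯) :
      lieDeriv (V - W) k x = lieDeriv V k x - lieDeriv W k x :=
    map_sub (mvfderiv (𝓡 d) k x) (V x) (W x)
  have swap (V W : VectorFields d M) : toBilin m V W x = -toBilin m W V x :=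
    congrArg (fun U : VectorFields d M => U x) (toBilin_swap m V W)
  have h1 := h.apply (funSMul f X) g Y x
  have h2 := h.apply (funSMul g Y) f X x
  rw [swap, h2, swap (funSMul g Y) X, swap (funSMul f X) Y, h.apply X g Y x, h.apply Y f X x,
    swap Y X] at h1
  rw [e, e, lieDeriv_funSMul_left, lieDeriv_funSMul_left]
  linear_combination (norm := module) -h1

/-- The symbol of a multiderivation of degree one is linear over the smooth functions. -/
theorem HasSymbol.map_funSMul [T2Space M] [NeZero d] (h : HasSymbol m σ) (f : C^∞⟮𝓡 d, M; ℝ⟯)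
    (X : VectorFields d M) : σ (funSMul f X) = funSMul f (σ X) := by
  ext1 x
  by_contra hne
  set W := σ (funSMul f X) - funSMul f (σ X) with hW
  have hW0 : W x ≠ 0 := sub_ne_zero.2 hne
  obtain ⟨g, hg⟩ : ∃ g, lieDeriv W g x ≠ 0 := by
    by_contra! hall
    exact hW0 (eq_zero_of_forall_mvfderiv hall)
  -- A nonzero defect makes `X x` span the tangent space, which is absurd for `d ≥ 2`. The rest of
  -- the argument also excludes `d = 1`.
  have hspan (Y : VectorFields d M) : ∃ c : ℝ, Y x = c • X x := by
    refine ⟨(lieDeriv W g x)⁻¹ * -lieDeriv (σ (funSMul g Y) - funSMul g (σ Y)) f x, ?_⟩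
    rw [mul_smul, neg_smul, ← h.defect_smul_eq, inv_smul_smul₀ hg]
  obtain ⟨Z, hZ⟩ := exists_vectorField_apply_ne_zero (d := d) x
  have hX : X x ≠ 0 := by
    intro hX
    obtain ⟨c, hc⟩ := hspan Z
    exact hZ (by rw [hc, hX, smul_zero])
  -- For `Y = X` and `g = f` the two sides of the defect identity are negatives of each other.
  have hWf : lieDeriv W f x = 0 := by
    have := h.defect_smul_eq X X f f x
    rw [← hW, eq_neg_iff_add_eq_zero, ← two_smul ℝ, smul_smul] at this
    simpa [hX] using this
  obtain ⟨c, hc⟩ := hspan W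
  have hXf : mvfderiv (𝓡 d) f x (X x) = 0 := by
    rw [lieDeriv_apply, hc, _root_.map_smul, smul_eq_mul, mul_eq_zero] at hWf
    refine hWf.resolve_left ?_
    rintro rfl
    exact hW0 (by rw [hc, zero_smul])
  have hYf (Y : VectorFields d M) : lieDeriv Y f x = 0 := by
    obtain ⟨c, hc⟩ := hspan Y
    rw [lieDeriv_apply, hc, _root_.map_smul, hXf, smul_zero]
  -- Since every vector field kills `f` at `x`, the right side vanishes, while the left is a nonzero
  -- multiple of `Z x`.
  have := h.defect_smul_eq X Z f g x
  rw [hYf, zero_smul, neg_zero, smul_eq_zero] at this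
  exact this.elim hg hZ

end Symbol

/-- The action of the symbols of a series of brackets satisfying the Jacobi identity. -/
theorem sum_lieDeriv_symbol [T2Space M] [NeZero d]
    {m : ℕ → (VectorFields d M) [⋀^Fin (1 + 1)]→ₗ[ℝ] (VectorFields d M)}
    {σ : ℕ → VectorFields d M → VectorFields d M} (h : ∀ k, HasSymbol (m k) (σ k)) {k : ℕ}
    (hJ : ∀ X Y Z, ∑ p ∈ antidiagonal k, (toBilin (m p.1) (toBilin (m p.2) X Y) Z -
      toBilin (m p.1) (toBilin (m p.2) X Z) Y + toBilin (m p.1) (toBilin (m p.2) Y Z) X) = 0)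
    (X Y : VectorFields d M) (f : C^∞⟮𝓡 d, M; ℝ⟯) (x : M) :
    ∑ p ∈ antidiagonal k, lieDeriv (σ p.1 (toBilin (m p.2) X Y)) f x =
      ∑ p ∈ antidiagonal k, (lieDeriv (σ p.1 X) (lieDeriv (σ p.2 Y) f) x -
        lieDeriv (σ p.1 Y) (lieDeriv (σ p.2 X) f) x) := by
  refine eq_of_forall_smul_eq (d := d) x fun Z => ?_
  have swap (i : ℕ) (V W : VectorFields d M) :
      toBilin (m i) V W x = -toBilin (m i) W V x :=
    congrArg (fun U : VectorFields d M => U x) (toBilin_swap (m i) V W)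
  have expand (i j : ℕ) (V W : VectorFields d M) :
      toBilin (m i) (toBilin (m j) V (funSMul f Z)) W x =
        f x • toBilin (m i) (toBilin (m j) V Z) W x - lieDeriv (σ i W) f x • toBilin (m j) V Z x -
        lieDeriv (σ j V) f x • toBilin (m i) W Z x -
        lieDeriv (σ i W) (lieDeriv (σ j V) f) x • Z x := by
    rw [swap i, h j V f Z, _root_.map_add, ContMDiffSection.coe_add, Pi.add_apply,
      (h i).apply, (h i).apply, swap i _ W, smul_neg]
    abel
  have h0 := congrArg (fun U : VectorFields d M => U x) (hJ X Y Z)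
  -- The Jacobi identity at `f Z` minus `f` times the one at `Z` leaves the terms in which `f` is
  -- differentiated.
  have h1 := congrArg (fun U : VectorFields d M => U x) (hJ X Y (funSMul f Z))
  simp only [sum_vectorField_apply, ContMDiffSection.coe_add, ContMDiffSection.coe_sub,
    ContMDiffSection.coe_zero, Pi.add_apply, Pi.sub_apply, Pi.zero_apply, expand,
    (h _).apply] at h0 h1
  have hsw (F : ℕ × ℕ → TangentSpace (𝓡 d) x) :
      ∑ p ∈ antidiagonal k, F p.swap = ∑ p ∈ antidiagonal k, F p :=
    sum_nbij' Prod.swap Prod.swap (by simp [add_comm]) (by simp [add_comm]) (by simp) (by simp)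
      (fun _ _ => rfl)
  -- The products of a first derivative of `f` with a bracket containing `Z` cancel in pairs once
  -- the two indices are exchanged; only multiples of `Z x` survive.
  have hX := hsw fun p => lieDeriv (σ p.1 X) f x • toBilin (m p.2) Y Z x
  have hY := hsw fun p => lieDeriv (σ p.1 Y) f x • toBilin (m p.2) X Z x
  have h0 := congrArg (fun v => f x • v) h0
  simp only [sum_add_distrib, sum_sub_distrib, Prod.fst_swap, Prod.snd_swap, smul_add, smul_sub,
    smul_zero, smul_sum, sum_smul, sub_smul] at h0 h1 hX hY ⊢
  linear_combination (norm := module) h1 - h0 - hX + hY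

/-- This is the case of `sum_lieDeriv_symbol` with symbol `id`: the commutator formula follows from
the Jacobi and Leibniz rules without coordinates. With `k = 0` only the zeroth bracket of the
constant family enters. -/
theorem lieDeriv_lieBracketFields [T2Space M] [NeZero d] (X Y : VectorFields d M)
    (f : C^∞⟮𝓡 d, M; ℝ⟯) (x : M) : lieDeriv (lieBracketFields X Y) f x =
      lieDeriv X (lieDeriv Y f) x - lieDeriv Y (lieDeriv X f) x := by
  have h := sum_lieDeriv_symbol (m := fun _ => tangentBracket d M) (σ := fun _ => id) (k := 0)
    (fun _ => hasSymbol_tangentBracket) (fun X Y Z => ?_) X Y f x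
  · simp only [Nat.antidiagonal_zero, sum_singleton] at h
    exact h
  · refine sum_eq_zero fun _ _ => ?_
    change lieBracketFields (lieBracketFields X Y) Z - lieBracketFields (lieBracketFields X Z) Y +
      lieBracketFields (lieBracketFields Y Z) X = 0
    rw [lieBracketFields_swap (lieBracketFields X Z) Y,
      lieBracketFields_swap (lieBracketFields Y Z) X, lieBracketFields_jacobi X Y Z]
    abel

/-- The symbol of a deformation intertwines it with the Lie bracket of vector fields. -/
theorem sum_symbol_eq [T2Space M] [NeZero d]
    {m : ℕ → (VectorFields d M) [⋀^Fin (1 + 1)]→ₗ[ℝ] (VectorFields d M)}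
    {σ : ℕ → VectorFields d M → VectorFields d M} (h : ∀ k, HasSymbol (m k) (σ k)) {k : ℕ}
    (hJ : cmBracketSeries (n := 2) rfl (fun i => ⇑(m i)) (fun i => ⇑(m i)) k = 0)
    (X Y : VectorFields d M) : ∑ p ∈ antidiagonal k, σ p.1 (toBilin (m p.2) X Y) =
      ∑ p ∈ antidiagonal k, toBilin (tangentBracket d M) (σ p.1 X) (σ p.2 Y) := by
  ext1 x
  refine vectorField_apply_eq_of_lieDeriv fun f => ?_
  rw [lieDeriv_sum_left, lieDeriv_sum_left, sum_lieDeriv_symbol h (sum_jacobi_eq_zero hJ)]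
  have hb (p : ℕ × ℕ) : lieDeriv (toBilin (tangentBracket d M) (σ p.1 X) (σ p.2 Y)) f x =
      lieDeriv (σ p.1 X) (lieDeriv (σ p.2 Y) f) x - lieDeriv (σ p.2 Y) (lieDeriv (σ p.1 X) f) x :=
    lieDeriv_lieBracketFields _ _ f x
  simp only [hb, sum_sub_distrib]
  congr 1
  exact sum_nbij' Prod.swap Prod.swap (by simp [add_comm]) (by simp [add_comm]) (by simp)
    (by simp) (fun _ _ => rfl)

/-! ### Rigidity -/

variable (d M) in
/-- The algebra of endomorphisms of the vector fields that are linear over the smooth functions. -/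
def smoothEnd : Subalgebra ℝ (Module.End ℝ (VectorFields d M)) where
  carrier := {T | ∀ (f : C^∞⟮𝓡 d, M; ℝ⟯) X, T (funSMul f X) = funSMul f (T X)}
  mul_mem' {S T} hS hT f X := by rw [Module.End.mul_apply, hT, hS]; rfl
  add_mem' {S T} hS hT f X := by
    rw [LinearMap.add_apply, hS, hT]
    ext1 x
    exact (smul_add (f x) (S X x) (T X x)).symm
  algebraMap_mem' c f X := by
    ext1 x
    exact smul_comm c (f x) (X x)

instance : IsScalarTower ℝ (smoothEnd d M) (VectorFields d M) := ⟨fun _ _ _ => rfl⟩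

/-- Linearity over the smooth functions is the Leibniz rule with symbol `0`. -/
theorem isMultiderivation_ofSubsingleton (T : smoothEnd d M) :
    IsMultiderivation (n := 0)
      (AlternatingMap.ofSubsingleton ℝ (VectorFields d M) (VectorFields d M) (0 : Fin 1)
        (T : Module.End ℝ (VectorFields d M))) := by
  refine ⟨fun _ => 0, fun s f e x => ?_⟩
  have h0 : (0 : VectorFields d M).applyFun f x = 0 := map_zero (mvfderiv (𝓡 d) f x)
  rw [h0, zero_smul, add_zero]
  exact congrArg (fun U : VectorFields d M => U x) (T.2 f e)

theorem HasSymbol.exists_smoothEnd [T2Space M] [NeZero d]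
    {m : (VectorFields d M) [⋀^Fin (1 + 1)]→ₗ[ℝ] (VectorFields d M)}
    {σ : VectorFields d M → VectorFields d M} (h : HasSymbol m σ) :
    ∃ T : smoothEnd d M, ∀ X, T • X = σ X :=
  ⟨⟨⟨⟨σ, h.map_add⟩, h.map_smul⟩, h.map_funSMul⟩, fun _ => rfl⟩

theorem isTrivialDeformation [T2Space M] [NeZero d]
    {m : ℕ → (VectorFields d M) [⋀^Fin (1 + 1)]→ₗ[ℝ] (VectorFields d M)}
    (hm : IsFormalDeformation (tangentBracket d M) m) :
    IsTrivialDeformation (tangentBracket d M) m := by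
  choose σ hσ using fun k => exists_hasSymbol (hm.isMultiderivation k)
  choose r hr using fun k => (hσ k).exists_smoothEnd
  -- The anchor of `TM` is the identity, and symbols are unique.
  have hr0 : r 0 = 1 := by
    refine Subtype.ext (LinearMap.ext fun X => ?_)
    have h0 := hσ 0
    rw [hm.zero] at h0
    exact (hr 0 X).trans (h0.unique hasSymbol_tangentBracket X)
  obtain ⟨D, hD0, hD⟩ := exists_expAd_eq hr0 m (tangentBracket d M) fun n X Y => by
    simp only [hr]
    exact sum_symbol_eq hσ (hm.bracket_self n) X Y
  refine ⟨fun k => AlternatingMap.ofSubsingleton ℝ (VectorFields d M) (VectorFields d M)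
    (0 : Fin 1) (D k : Module.End ℝ (VectorFields d M)), ?_,
    fun k => isMultiderivation_ofSubsingleton (D k), fun k => (hD k).symm⟩
  dsimp only
  rw [hD0]
  ext
  rfl

theorem isTrivialDeformation_of_subsingleton [Subsingleton (VectorFields d M)]
    (m₀ : (VectorFields d M) [⋀^Fin (1 + 1)]→ₗ[ℝ] (VectorFields d M))
    (m : ℕ → (VectorFields d M) [⋀^Fin (1 + 1)]→ₗ[ℝ] (VectorFields d M)) :
    IsTrivialDeformation m₀ m := by
  refine ⟨fun _ => 0, rfl, fun k => ⟨fun _ => 0, fun s f e x => ?_⟩, fun k => ?_⟩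
  · have h0 : (0 : VectorFields d M).applyFun f x = 0 := map_zero (mvfderiv (𝓡 d) f x)
    rw [h0, zero_smul, add_zero]
    exact (smul_zero (f x)).symm
  · exact funext fun s => Subsingleton.elim _ _

end Geometry

end TangentRigidity

end

theorem mainTheorem12 (d : ℕ) (M : Type*) [TopologicalSpace M] [T2Space M]
    [ChartedSpace (EuclideanSpace ℝ (Fin d)) M] [IsManifold (𝓡 d) ∞ M] :
    (LieAlgebroidDef.tangentLieAlgebroid d M).IsRigid := by
  intro m hm
  obtain rfl | hd := Nat.eq_zero_or_pos d
  -- In dimension zero symbols are not determined by a Leibniz rule used on nonzero vectors, but the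
  -- space of vector fields is trivial and `D_t = 0` works.
  · have : Subsingleton (LieAlgebroidDef.VectorFields 0 M) :=
      ⟨fun X Y => ContMDiffSection.ext fun x =>
        Subsingleton.elim (α := EuclideanSpace ℝ (Fin 0)) (X x) (Y x)⟩
    exact TangentRigidity.isTrivialDeformation_of_subsingleton _ m
  · have : NeZero d := ⟨hd.ne'⟩
    exact TangentRigidity.isTrivialDeformation hm
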